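/- Let $(M,\omega)$ be a symplectic manifold of dimension $2n$, and let $(L,a)$ be prequantization data on it: a smooth hermitian line bundle $L\to M$ with a hermitian connection $a$, with covariant derivative $\nabla_a$, whose curvature form is $F_a=2\pi i\,\omega$. Let $s$ be a smooth section of $L$ with zero set $D_s=\{x\in M: s(x)=0\}$, and let $$\rho_s=\frac{\nabla_a s}{s}=\frac{\langle\nabla_a s,s\rangle}{\langle s,s\rangle},$$ a complex $1$-form defined on $M\setminus D_s$. Let $S\subset M$ be a smooth embedded submanifold of dimension $n$. Call $S$ an $s$-special Bohr–Sommerfeld Lagrangian submanifold if - $\omega|_S\equiv 0$; - the restriction $(L,a)|_S$ admits a covariantly constant nowhere vanishing section $\sigma_S$; - $s$ vanishes nowhere on $S$ and, for such a $\sigma_S$, $s|_S=f\,e^{ic}\,\sigma_S$ with a real constant $c$ and a positive real function $f$ on $S$. Say that the restriction of $\operatorname{Im}\rho_s$ to $S$ vanishes identically if, at every point $x\in S$, the form $\rho_s$ is defined (that is, $x\notin D_s$) and $\operatorname{Im}\rho_s(v)=0$ for all $v\in T_xS$. Then $S$ is an $s$-special Bohr–Sommerfeld Lagrangian submanifold if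 and only if the restriction of $\operatorname{Im}\rho_s$ to $S$ vanishes identically; in that case $S\cap D_s=\emptyset$. -/

import Mathlib

open Bundle Manifold Set VectorField
open scoped Manifold ContDiff Topology ComplexInnerProductSpace

noncomputable section

namespace SBS

/-- The model vector space of real dimension `k`. -/
abbrev Vec (k : ℕ) := EuclideanSpace ℝ (Fin k)

/-! ### Symplectic manifolds -/

section Symplectic

/-- `X` is a smooth vector field over the subset `U` of the `m`-dimensional manifold `M`. -/
def SmoothFieldOn {m : ℕ} {M : Type*} [TopologicalSpace M] [ChartedSpace (Vec m) M]
    [IsManifold (𝓡 m) ∞ M] (X : Π x : M, TangentSpace (𝓡 m) x) (U : Set M) : Prop :=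
  ContMDiffOn (𝓡 m) (𝓡 m).tangent ∞ (fun x ↦ (⟨x, X x⟩ : TangentBundle (𝓡 m) M)) U

/-- A symplectic form on a smooth manifold of dimension `2n`: a smooth closed nondegenerate
differential `2`-form. In `closed`, the left-hand side is `dΩ (X, Y, Z)`. -/
structure SymplecticForm (n : ℕ) (M : Type*) [TopologicalSpace M]
    [ChartedSpace (Vec (2 * n)) M] [IsManifold (𝓡 (2 * n)) ∞ M] where
  /-- The bilinear form on each tangent space. -/
  form : Π x : M, TangentSpace (𝓡 (2 * n)) x →L[ℝ] TangentSpace (𝓡 (2 * n)) x →L[ℝ] ℝ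
  alternating : ∀ (x : M) (v : TangentSpace (𝓡 (2 * n)) x), form x v v = 0
  nondegenerate : ∀ (x : M) (v : TangentSpace (𝓡 (2 * n)) x),
    (∀ w : TangentSpace (𝓡 (2 * n)) x, form x v w = 0) → v = 0
  smooth : ContMDiff (𝓡 (2 * n))
    ((𝓡 (2 * n)).prod 𝓘(ℝ, Vec (2 * n) →L[ℝ] Vec (2 * n) →L[ℝ] ℝ)) ∞
    (fun x ↦ TotalSpace.mk' (Vec (2 * n) →L[ℝ] Vec (2 * n) →L[ℝ] ℝ)
      (E := fun x : M ↦
        TangentSpace (𝓡 (2 * n)) x →L[ℝ] TangentSpace (𝓡 (2 * n)) x →L[ℝ] ℝ) x (form x))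
  closed : ∀ U : Set M, IsOpen U → ∀ X Y Z : Π x : M, TangentSpace (𝓡 (2 * n)) x,
    SmoothFieldOn X U → SmoothFieldOn Y U → SmoothFieldOn Z U → ∀ x ∈ U,
      mvfderiv (𝓡 (2 * n)) (fun y ↦ form y (Y y) (Z y)) x (X x)
        - mvfderiv (𝓡 (2 * n)) (fun y ↦ form y (X y) (Z y)) x (Y x)
        + mvfderiv (𝓡 (2 * n)) (fun y ↦ form y (X y) (Y y)) x (Z x)
        - form x (mlieBracket (𝓡 (2 * n)) X Y x) (Z x)
        + form x (mlieBracket (𝓡 (2 * n)) X Z x) (Y x)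
        - form x (mlieBracket (𝓡 (2 * n)) Y Z x) (X x) = 0

end Symplectic

/-! ### Prequantization data

A smooth complex line bundle over the real manifold `M` is a fibre bundle `L` with model fibre `ℂ`
which is a complex vector bundle (`VectorBundle ℂ ℂ L`, so that the local trivializations are
fibrewise `ℂ`-linear) and a smooth real vector bundle (`VectorBundle ℝ ℂ L`,
`ContMDiffVectorBundle ∞ ℂ L (𝓡 (2 * n))`, so that the transition functions are smooth). The
hermitian structure is the complex inner product of the fibres. As everywhere in Mathlib,
`⟪u, v⟫_ℂ` is conjugate-linear in `u` and linear in `v`. -/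

section Prequantum

variable {n : ℕ} {M : Type*} [TopologicalSpace M] [ChartedSpace (Vec (2 * n)) M]
  [IsManifold (𝓡 (2 * n)) ∞ M]
  {L : M → Type*} [TopologicalSpace (TotalSpace ℂ L)]
  [∀ x, NormedAddCommGroup (L x)] [∀ x, InnerProductSpace ℂ (L x)] [FiberBundle ℂ L]

variable (n) in
/-- `s` is a smooth section of `L` over the subset `U` of `M`. -/
def SmoothSectionOn (s : Π x : M, L x) (U : Set M) : Prop :=
  ContMDiffOn (𝓡 (2 * n)) ((𝓡 (2 * n)).prod 𝓘(ℝ, ℂ)) ∞ (fun x ↦ TotalSpace.mk' ℂ x (s x)) U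

variable (n) in
/-- `s` is a section of `L` which is differentiable at `x`. -/
def SectionDiffAt (s : Π x : M, L x) (x : M) : Prop :=
  MDifferentiableAt (𝓡 (2 * n)) ((𝓡 (2 * n)).prod 𝓘(ℝ, ℂ)) (fun y ↦ TotalSpace.mk' ℂ y (s y)) x

variable [VectorBundle ℂ ℂ L] [VectorBundle ℝ ℂ L] [ContMDiffVectorBundle ∞ ℂ L (𝓡 (2 * n))]

variable (L) in
/-- Prequantization data on the symplectic manifold `(M, Ω)` with line bundle `L`: the inner product
of the fibres is a smooth hermitian structure on `L`, and `conn` is a smooth hermitian connection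
whose curvature form is `2πi Ω`. Here `conn s x v` is the covariant derivative `∇_v s` of the
section `s` in the direction of the tangent vector `v` at `x`. -/
structure Prequantization (Ω : SymplecticForm n M) where
  /-- The covariant derivative of the prequantization connection (a real Koszul connection). -/
  conn : CovariantDerivative (𝓡 (2 * n)) ℂ L
  /-- The hermitian structure is smooth. -/
  smooth_inner : ∀ U : Set M, IsOpen U → ∀ s t : Π x : M, L x,
    SmoothSectionOn n s U → SmoothSectionOn n t U →
      ContMDiffOn (𝓡 (2 * n)) 𝓘(ℝ, ℂ) ∞ (fun x ↦ ⟪s x, t x⟫) U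
  /-- The connection is smooth. -/
  smooth_conn : CovariantDerivative.ContMDiffCovariantDerivative conn ∞
  /-- The covariant derivative commutes with multiplication by `i`. -/
  conn_I : ∀ (s : Π x : M, L x) (x : M), SectionDiffAt n s x →
    ∀ v : TangentSpace (𝓡 (2 * n)) x,
      conn (fun y ↦ Complex.I • s y) x v = Complex.I • conn s x v
  /-- The connection is hermitian: `d⟨s, t⟩ = ⟨∇s, t⟩ + ⟨s, ∇t⟩`. -/
  hermitian : ∀ (s t : Π x : M, L x) (x : M), SectionDiffAt n s x → SectionDiffAt n t x →
    ∀ v : TangentSpace (𝓡 (2 * n)) x,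
      mvfderiv (𝓡 (2 * n)) (fun y ↦ ⟪s y, t y⟫) x v = ⟪conn s x v, t x⟫ + ⟪s x, conn t x v⟫
  /-- The curvature form is `2πi Ω`: `∇_X ∇_Y s - ∇_Y ∇_X s - ∇_[X,Y] s = 2πi Ω(X, Y) s`. -/
  curvature : ∀ U : Set M, IsOpen U → ∀ (X Y : Π x : M, TangentSpace (𝓡 (2 * n)) x)
    (s : Π x : M, L x), SmoothFieldOn X U → SmoothFieldOn Y U → SmoothSectionOn n s U → ∀ x ∈ U,
      conn (fun y ↦ conn s y (Y y)) x (X x) - conn (fun y ↦ conn s y (X y)) x (Y x)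
        - conn s x (mlieBracket (𝓡 (2 * n)) X Y x)
        = (2 * (Real.pi : ℂ) * Complex.I * (Ω.form x (X x) (Y x) : ℂ)) • s x

variable {Ω : SymplecticForm n M}

/-- The zero set `D_s` of a section `s`. -/
def zeroSet (s : Π x : M, L x) : Set M := {x | s x = 0}

/-- The complex `1`-form `ρ_s = ∇s / s = ⟨∇s, s⟩ / ⟨s, s⟩`, which lives on `M ∖ D_s`. -/
def rho (a : Prequantization L Ω) (s : Π x : M, L x) (x : ↥(zeroSet s)ᶜ)
    (v : TangentSpace (𝓡 (2 * n)) (x : M)) : ℂ :=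
  ⟪s x, a.conn s x v⟫ / ⟪s x, s x⟫

/-! ### Submanifolds

A submanifold of `M` is presented by a smooth embedding `ι : S → M` of a manifold `S`; the tangent
space of the submanifold at `ι x` is the range of `mfderiv ι x`. -/

variable {S : Type*} [TopologicalSpace S] [ChartedSpace (Vec n) S] [IsManifold (𝓡 n) ∞ S]

/-- The `n`-dimensional submanifold `ι : S → M` is Lagrangian: `Ω` restricts to zero on it. -/
def IsLagrangian (Ω : SymplecticForm n M) (ι : S → M) : Prop :=
  ∀ (x : S) (u v : TangentSpace (𝓡 n) x),
    Ω.form (ι x) (mfderiv (𝓡 n) (𝓡 (2 * n)) ι x u) (mfderiv (𝓡 n) (𝓡 (2 * n)) ι x v) = 0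

/-- `σ` is a covariantly constant smooth section of the restriction `(L, a)|_S`. The restricted
connection is given by `∇_v (g · t|_S) = dg(v) · t|_S + g · ∇_{dι(v)} t` for local frames `t` of `L`
and complex functions `g` on `S`; so `σ` is covariantly constant if this expression vanishes
whenever `σ = g · t|_S` near a point. (The local trivializations of `L` supply a smooth frame `t`
near any point of `M`, and then `g` exists, is unique and smooth.) -/
def IsCovariantlyConstant (a : Prequantization L Ω) (ι : S → M) (σ : Π x : S, L (ι x)) : Prop :=
  ContMDiff (𝓡 n) ((𝓡 (2 * n)).prod 𝓘(ℝ, ℂ)) ∞ (fun x ↦ TotalSpace.mk' ℂ (ι x) (σ x)) ∧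
  ∀ (x : S) (U : Set M), IsOpen U → ι x ∈ U →
    ∀ t : Π y : M, L y, SmoothSectionOn n t U → (∀ y ∈ U, t y ≠ 0) →
    ∀ g : S → ℂ, MDifferentiableAt (𝓡 n) 𝓘(ℝ, ℂ) g x → (∀ᶠ y in 𝓝 x, σ y = g y • t (ι y)) →
    ∀ v : TangentSpace (𝓡 n) x,
      mvfderiv (𝓡 n) g x v • t (ι x)
        + g x • a.conn t (ι x) (mfderiv (𝓡 n) (𝓡 (2 * n)) ι x v) = 0

/-- `σ` is a covariantly constant section `σ_S` of `(L, a)|_S` as in the Bohr-Sommerfeld condition,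
that is, a nowhere vanishing one (the zero section is always covariantly constant). -/
def IsBSSection (a : Prequantization L Ω) (ι : S → M) (σ : Π x : S, L (ι x)) : Prop :=
  IsCovariantlyConstant a ι σ ∧ ∀ x, σ x ≠ 0

/-- A Lagrangian submanifold satisfies the Bohr-Sommerfeld condition if the restriction `(L, a)|_S`
admits a (nonzero) covariantly constant section. -/
def IsBohrSommerfeld (a : Prequantization L Ω) (ι : S → M) : Prop :=
  IsLagrangian Ω ι ∧ ∃ σ : Π x : S, L (ι x), IsBSSection a ι σ

/-- `S` is an `s`-special Bohr-Sommerfeld Lagrangian submanifold: it is a Bohr-Sommerfeld Lagrangian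
submanifold, `s` vanishes nowhere on `S`, and `s|_S = f e^{ic} σ_S` with `c` a real constant and
`f` a real positive function. -/
def IsSpecialBS (a : Prequantization L Ω) (s : Π x : M, L x) (ι : S → M) : Prop :=
  IsBohrSommerfeld a ι ∧ (∀ x : S, s (ι x) ≠ 0) ∧
  ∃ σ : Π x : S, L (ι x), IsBSSection a ι σ ∧ ∃ (c : ℝ) (f : S → ℝ), (∀ x, 0 < f x) ∧
    ∀ x, s (ι x) = ((f x : ℂ) * Complex.exp (Complex.I * (c : ℂ))) • σ x

/-- The restriction of the `1`-form `Im ρ_s` to `S` vanishes identically: at every point of `S` the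
form is defined and annihilates the tangent space of `S`. -/
def ImRhoVanishesOn (a : Prequantization L Ω) (s : Π x : M, L x) (ι : S → M) : Prop :=
  ∀ x : S, ∃ hx : ι x ∈ (zeroSet s)ᶜ, ∀ v : TangentSpace (𝓡 n) x,
    (rho a s ⟨ι x, hx⟩ (mfderiv (𝓡 n) (𝓡 (2 * n)) ι x v)).im = 0

end Prequantum

end SBS

end

/-! Fibres of `L` are complex lines, so off the zeros of `s` one has `∇s = ρ s`, and every statement
becomes one about the scalar form `ρ`.

Suppose `Im ρ` vanishes on `S`. The curvature identity says `dρ = 2πi Ω`; restricting its imaginary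
part to `S` gives `2π Ω|_S = d(Im ρ|_S) = 0`, so `S` is Lagrangian (`ImRhoVanishesOn.isLagrangian`).
Moreover `∇(s/|s|) = i (Im ρ) s/|s|`, because the hermitian property removes the real part; hence
`s/|s|` is parallel along `S` (`conn_unitSection`). It serves as `σ_S`, with `f = |s|` and `c = 0`.

Conversely, let `s = f e^{ic} σ` with `σ` parallel on `S`, and put `g = (f e^{ic})⁻¹`, so `σ = g s`.
Then `dg + g ρ = 0` on `S`, hence `ρ = -f e^{ic} dg`. This is real since `e^{ic} g = 1/f` is a real
function (`IsSpecialBS.imRhoVanishesOn`). -/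

noncomputable section

set_option linter.unusedSectionVars false

namespace SBS

/-! ### Commuting coordinate vector fields -/

section CoordinateFields

variable {E : Type*} [NormedAddCommGroup E] [NormedSpace ℝ E]
  {M : Type*} [TopologicalSpace M] [ChartedSpace E M]

/-- The constant vector field on a vector space. -/
def constField (u : E) : Π x : E, TangentSpace 𝓘(ℝ, E) x := fun _ ↦ u

/-- The coordinate vector field of the chart `φ` in the constant direction `u`. -/
def coordField (φ : OpenPartialHomeomorph M E) (u : E) :
    Π x : M, TangentSpace 𝓘(ℝ, E) x :=
  mpullback 𝓘(ℝ, E) 𝓘(ℝ, E) φ (constField u)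

lemma isInvertible_mfderiv_of_mem_maximalAtlas {φ : OpenPartialHomeomorph M E}
    (hφ : φ ∈ IsManifold.maximalAtlas 𝓘(ℝ, E) ∞ M) {x : M} (hx : x ∈ φ.source) :
    (mfderiv 𝓘(ℝ, E) 𝓘(ℝ, E) φ x).IsInvertible := by
  have h : φ.MDifferentiable 𝓘(ℝ, E) 𝓘(ℝ, E) :=
    ⟨fun y hy ↦ ((contMDiffAt_of_mem_maximalAtlas hφ hy).mdifferentiableAt
        (by simp)).mdifferentiableWithinAt,
      fun y hy ↦ ((contMDiffAt_symm_of_mem_maximalAtlas hφ hy).mdifferentiableAt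
        (by simp)).mdifferentiableWithinAt⟩
  exact ⟨h.mfderiv hx, rfl⟩

lemma contMDiff_constField (u : E) :
    ContMDiff 𝓘(ℝ, E) 𝓘(ℝ, E).tangent ∞
      (fun x ↦ (⟨x, constField u x⟩ : TangentBundle 𝓘(ℝ, E) E)) := by
  intro x
  rw [contMDiffAt_vectorSpace_iff_contDiffAt]
  exact contDiffAt_const (c := u)

lemma coordField_mfderiv {φ : OpenPartialHomeomorph M E}
    (hφ : φ ∈ IsManifold.maximalAtlas 𝓘(ℝ, E) ∞ M) {x : M} (hx : x ∈ φ.source)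
    (w : TangentSpace 𝓘(ℝ, E) x) :
    coordField φ (mfderiv 𝓘(ℝ, E) 𝓘(ℝ, E) φ x w) x = w := by
  change (mfderiv 𝓘(ℝ, E) 𝓘(ℝ, E) φ x).inverse (mfderiv 𝓘(ℝ, E) 𝓘(ℝ, E) φ x w) = w
  obtain ⟨e, he⟩ := isInvertible_mfderiv_of_mem_maximalAtlas hφ hx
  rw [← he]
  simp

variable [CompleteSpace E] [IsManifold 𝓘(ℝ, E) ∞ M]

lemma contMDiffOn_coordField {φ : OpenPartialHomeomorph M E}
    (hφ : φ ∈ IsManifold.maximalAtlas 𝓘(ℝ, E) ∞ M) (u : E) :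
    ContMDiffOn 𝓘(ℝ, E) 𝓘(ℝ, E).tangent ∞
      (fun x ↦ (⟨x, coordField φ u x⟩ : TangentBundle 𝓘(ℝ, E) M)) φ.source := fun x hx ↦
  (ContMDiffAt.mpullback_vectorField_preimage (contMDiff_constField u _)
    (contMDiffAt_of_mem_maximalAtlas hφ hx)
    (isInvertible_mfderiv_of_mem_maximalAtlas hφ hx) (by simp)).contMDiffWithinAt

/-- Pullback by a chart respects Lie brackets, and constant fields commute. This removes the bracket
term from the curvature identity. -/
lemma mlieBracket_coordField {φ : OpenPartialHomeomorph M E}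
    (hφ : φ ∈ IsManifold.maximalAtlas 𝓘(ℝ, E) ∞ M) (u v : E) {x : M} (hx : x ∈ φ.source) :
    mlieBracket 𝓘(ℝ, E) (coordField φ u) (coordField φ v) x = 0 := by
  have h2 : minSmoothness ℝ 2 ≤ ∞ := by
    rw [minSmoothness_of_isRCLikeNormedField]
    exact WithTop.coe_le_coe.2 le_top
  have h3 : minSmoothness ℝ 3 ≤ ∞ := by
    rw [minSmoothness_of_isRCLikeNormedField]
    exact WithTop.coe_le_coe.2 le_top
  have : IsManifold 𝓘(ℝ, E) (minSmoothness ℝ 3) M := .of_le h3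
  have : IsManifold 𝓘(ℝ, E) (minSmoothness ℝ 2) M := .of_le h2
  unfold coordField
  rw [← mpullback_mlieBracket ((contMDiff_constField u _).mdifferentiableAt (by simp))
    ((contMDiff_constField v _).mdifferentiableAt (by simp))
    (contMDiffAt_of_mem_maximalAtlas hφ hx) h2]
  have h0 : mlieBracket 𝓘(ℝ, E) (constField u) (constField v) (φ x) = 0 := by
    rw [← mlieBracketWithin_univ, mlieBracketWithin_eq_lieBracketWithin]
    unfold lieBracketWithin
    have hc (w : E) : fderivWithin ℝ (constField w) univ (φ x) = 0 :=
      fderivWithin_const_apply (c := w)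
    rw [hc, hc]
    exact sub_self (0 : E)
  rw [mpullback_apply, h0, map_zero]

end CoordinateFields

/-! ### Coordinate fields tangent to an immersed submanifold -/

section Immersion

variable {k m : ℕ} {S : Type*} [TopologicalSpace S] [ChartedSpace (Vec k) S]
  [IsManifold (𝓡 k) ∞ S]
  {M : Type*} [TopologicalSpace M] [ChartedSpace (Vec m) M] [IsManifold (𝓡 m) ∞ M]

/-- Near a point of an immersed submanifold, the tangent vectors of the submanifold extend to
coordinate fields which are tangent to the submanifold. -/
lemma exists_coordField_tangent {ι : S → M} {x : S} (h : IsImmersionAt (𝓡 k) (𝓡 m) ∞ ι x) :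
    ∃ φ ∈ IsManifold.maximalAtlas (𝓡 m) ∞ M, ι x ∈ φ.source ∧
      ∀ u : TangentSpace (𝓡 k) x, ∃ u' : Vec m,
        coordField φ u' (ι x) = mfderiv (𝓡 k) (𝓡 m) ι x u ∧
        ∀ᶠ y in 𝓝 x, ∃ w : TangentSpace (𝓡 k) y,
          coordField φ u' (ι y) = mfderiv (𝓡 k) (𝓡 m) ι y w := by
  have hc := h.contMDiffAt
  obtain ⟨F, _, _, h⟩ := h
  set ψ := h.domChart
  set φ := h.codChart
  have hψ := h.domChart_mem_maximalAtlas
  have hφ := h.codChart_mem_maximalAtlas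
  -- In the charts `ψ`, `φ` adapted to the immersion, `ι` is the linear map `p ↦ (p, 0)`; this is
  -- `T`.
  let T : Vec k →L[ℝ] Vec m := (h.equiv : (Vec k × F) →L[ℝ] Vec m) ∘L .inl ℝ (Vec k) F
  have heq : ∀ y ∈ ψ.source, φ (ι y) = T (ψ y) := by
    intro y hy
    have hm : ψ y ∈ (h.domChart.extend (𝓡 k)).target := by simpa [ψ] using ψ.map_source hy
    have := h.writtenInCharts hm
    simpa [T, ψ, φ, hy] using this
  -- The chain rule for `φ ∘ ι = T ∘ ψ`: the coordinate field in direction `T (dψ w)` takes the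
  -- value `dι w`.
  have hder : ∀ y ∈ ψ.source, MDifferentiableAt (𝓡 k) (𝓡 m) ι y →
      ∀ w : TangentSpace (𝓡 k) y,
      coordField φ (T (mfderiv (𝓡 k) 𝓘(ℝ, Vec k) ψ y w)) (ι y) = mfderiv (𝓡 k) (𝓡 m) ι y w := by
    intro y hy hιy w
    have hy' : ι y ∈ φ.source := h.source_subset_preimage_source hy
    have e1 : mfderiv (𝓡 k) 𝓘(ℝ, Vec m) (φ ∘ ι) y = mfderiv (𝓡 k) 𝓘(ℝ, Vec m) (T ∘ ψ) y := by
      apply Filter.EventuallyEq.mfderiv_eq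
      filter_upwards [ψ.open_source.mem_nhds hy] with z hz using heq z hz
    have hφd := (contMDiffAt_of_mem_maximalAtlas hφ hy').mdifferentiableAt (by simp)
    have hψd := (contMDiffAt_of_mem_maximalAtlas hψ hy).mdifferentiableAt (by simp)
    rw [mfderiv_comp y hφd hιy, mfderiv_comp y T.mdifferentiableAt hψd] at e1
    have e2 := congrArg (fun A ↦ A w) e1
    simp only [ContinuousLinearMap.comp_apply, ContinuousLinearMap.mfderiv_eq] at e2
    rw [← coordField_mfderiv hφ hy' (mfderiv (𝓡 k) (𝓡 m) ι y w)]
    congr 1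
    exact e2.symm
  refine ⟨φ, hφ, h.mem_codChart_source, fun u ↦
    ⟨T (mfderiv (𝓡 k) 𝓘(ℝ, Vec k) ψ x u),
      hder x h.mem_domChart_source (hc.mdifferentiableAt (by simp)) u, ?_⟩⟩
  -- The chain rule is needed at all points near `x`, so `ι` must be differentiable there too.
  have hev : ∀ᶠ y in 𝓝 x, ContMDiffAt (𝓡 k) (𝓡 m) 1 ι y :=
    (contMDiffAt_iff_contMDiffAt_nhds (by simp)).1 (hc.of_le (by simp))
  filter_upwards [hev, ψ.open_source.mem_nhds h.mem_domChart_source] with y hy hyψ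
  obtain ⟨e, he⟩ := isInvertible_mfderiv_of_mem_maximalAtlas hψ hyψ
  -- The vector at `y` with the same `ψ`-coordinates as `u` has at `x`.
  refine ⟨e.symm (mfderiv (𝓡 k) 𝓘(ℝ, Vec k) ψ x u), ?_⟩
  rw [← hder y hyψ (hy.mdifferentiableAt (by simp)), ← he]
  congr 2
  exact (e.apply_symm_apply _).symm

end Immersion

/-! ### Derivatives of vector-valued functions -/

section RealLinear

variable {E : Type*} [NormedAddCommGroup E] [NormedSpace ℝ E] {H : Type*} [TopologicalSpace H]
  {I : ModelWithCorners ℝ E H} {N : Type*} [TopologicalSpace N] [ChartedSpace H N]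
  {V W : Type*} [NormedAddCommGroup V] [NormedSpace ℝ V] [NormedAddCommGroup W] [NormedSpace ℝ W]

lemma mvfderiv_clm_comp (T : V →L[ℝ] W) {g : N → V} {x : N}
    (hg : MDifferentiableAt I 𝓘(ℝ, V) g x) (v : TangentSpace I x) :
    mvfderiv I (fun y ↦ T (g y)) x v = T (mvfderiv I g x v) := by
  have h := mfderiv_comp_apply x (T.mdifferentiableAt (x := g x)) hg v
  rw [ContinuousLinearMap.mfderiv_eq] at h
  exact h

lemma mdifferentiableAt_clm_comp (T : V →L[ℝ] W) {g : N → V} {x : N}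
    (hg : MDifferentiableAt I 𝓘(ℝ, V) g x) :
    MDifferentiableAt I 𝓘(ℝ, W) (fun y ↦ T (g y)) x :=
  (T.mdifferentiableAt (x := g x)).comp x hg

lemma mvfderiv_congr {g g' : N → V} {x : N} (h : g =ᶠ[𝓝 x] g') (v : TangentSpace I x) :
    mvfderiv I g x v = mvfderiv I g' x v := by
  have h1 : mfderiv I 𝓘(ℝ, V) g x = mfderiv I 𝓘(ℝ, V) g' x := h.mfderiv_eq
  exact congrArg (fun A : E →L[ℝ] V ↦ A v) h1

lemma mvfderiv_comp_mfderiv {E' : Type*} [NormedAddCommGroup E'] [NormedSpace ℝ E']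
    {H' : Type*} [TopologicalSpace H'] {I' : ModelWithCorners ℝ E' H'}
    {N' : Type*} [TopologicalSpace N'] [ChartedSpace H' N'] {f : N' → N} {g : N → V} {x : N'}
    (hg : MDifferentiableAt I 𝓘(ℝ, V) g (f x)) (hf : MDifferentiableAt I' I f x)
    (v : TangentSpace I' x) :
    mvfderiv I' (fun y ↦ g (f y)) x v = mvfderiv I g (f x) (mfderiv I' I f x v) :=
  mfderiv_comp_apply x hg hf v

lemma mvfderiv_mul_complex {f g : N → ℂ} {x : N} (hf : MDifferentiableAt I 𝓘(ℝ, ℂ) f x)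
    (hg : MDifferentiableAt I 𝓘(ℝ, ℂ) g x) (v : TangentSpace I x) :
    mvfderiv I (fun y ↦ f y * g y) x v = f x * mvfderiv I g x v + g x * mvfderiv I f x v := by
  have h := (hf.hasMFDerivAt.mul' hg.hasMFDerivAt).mfderiv
  have h1 := congrArg (fun A : E →L[ℝ] ℂ ↦ A v) h
  refine h1.trans ?_
  change f x * mvfderiv I g x v + mvfderiv I f x v * g x = _
  ring

end RealLinear

/-! ### Complex lines -/

section Line

/-- In a line, orthogonal projection onto `s` is the identity. This is what makes `⟨∇s, s⟩ / ⟨s, s⟩`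
an honest quotient `∇s / s`. -/
lemma line_smul_eq {V : Type*} [NormedAddCommGroup V] [InnerProductSpace ℂ V]
    (hV : Module.finrank ℂ V = 1) {s : V} (hs : s ≠ 0) (v : V) :
    (⟪s, v⟫ / ⟪s, s⟫) • s = v := by
  obtain ⟨c, rfl⟩ := exists_smul_eq_of_finrank_eq_one hV hs v
  rw [inner_smul_right, mul_div_cancel_right₀ _ (inner_self_ne_zero.2 hs)]

end Line

/-! ### Sections and the connection of the line bundle -/

section Prequantum

variable {n : ℕ} {M : Type*} [TopologicalSpace M] [ChartedSpace (Vec (2 * n)) M]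
  [IsManifold (𝓡 (2 * n)) ∞ M]
  {L : M → Type*} [TopologicalSpace (TotalSpace ℂ L)]
  [∀ x, NormedAddCommGroup (L x)] [∀ x, InnerProductSpace ℂ (L x)] [FiberBundle ℂ L]
  [VectorBundle ℂ ℂ L] [VectorBundle ℝ ℂ L] [ContMDiffVectorBundle ∞ ℂ L (𝓡 (2 * n))]

variable (L) in
lemma finrank_fiber (x : M) : Module.finrank ℂ (L x) = 1 := by
  let e := (trivializationAt ℂ L x).continuousLinearEquivAt ℂ x (mem_baseSet_trivializationAt ℂ L x)
  rw [e.toLinearEquiv.finrank_eq, Module.finrank_self]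

lemma trivializationAt_smul (x₀ : M) {x : M} (hx : x ∈ (trivializationAt ℂ L x₀).baseSet)
    (c : ℂ) (v : L x) :
    (trivializationAt ℂ L x₀ ⟨x, c • v⟩).2 = c * (trivializationAt ℂ L x₀ ⟨x, v⟩).2 :=
  ((trivializationAt ℂ L x₀).linear ℂ hx).map_smul c v

lemma trivializationAt_ne_zero (x₀ : M) {x : M} (hx : x ∈ (trivializationAt ℂ L x₀).baseSet)
    {v : L x} (hv : v ≠ 0) : (trivializationAt ℂ L x₀ ⟨x, v⟩).2 ≠ 0 := by
  intro h
  let e := (trivializationAt ℂ L x₀).continuousLinearEquivAt ℂ x hx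
  exact hv (e.map_eq_zero_iff.1 h)

lemma eventually_mem_baseSet (x : M) : ∀ᶠ y in 𝓝 x, y ∈ (trivializationAt ℂ L x).baseSet :=
  (trivializationAt ℂ L x).open_baseSet.mem_nhds (mem_baseSet_trivializationAt ℂ L x)

lemma SectionDiffAt.congr {s t : Π x : M, L x} {x : M} (hs : SectionDiffAt n s x)
    (h : ∀ᶠ y in 𝓝 x, s y = t y) : SectionDiffAt n t x := by
  refine MDifferentiableAt.congr_of_eventuallyEq hs ?_
  filter_upwards [h] with y hy
  simp [hy]

lemma SectionDiffAt.smul {s : Π x : M, L x} {h : M → ℂ} {x : M} (hs : SectionDiffAt n s x)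
    (hh : MDifferentiableAt (𝓡 (2 * n)) 𝓘(ℝ, ℂ) h x) :
    SectionDiffAt n (fun y ↦ h y • s y) x := by
  rw [SectionDiffAt, mdifferentiableAt_section] at hs ⊢
  refine (MDifferentiableAt.mul hh hs).congr_of_eventuallyEq ?_
  filter_upwards [eventually_mem_baseSet (L := L) x] with y hy
  exact trivializationAt_smul x hy _ _

lemma SmoothSectionOn.sectionDiffAt {s : Π x : M, L x} {U : Set M} (hs : SmoothSectionOn n s U)
    (hU : IsOpen U) {x : M} (hx : x ∈ U) : SectionDiffAt n s x :=
  (hs.contMDiffAt (hU.mem_nhds hx)).mdifferentiableAt (by simp)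

lemma isOpen_compl_zeroSet {s : Π x : M, L x} (hs : SmoothSectionOn n s univ) :
    IsOpen (zeroSet s)ᶜ := by
  rw [isOpen_iff_mem_nhds]
  intro x hx
  have h := (mdifferentiableAt_section (IB := 𝓡 (2 * n)) s).1
    (hs.sectionDiffAt isOpen_univ (mem_univ x))
  filter_upwards [h.continuousAt.eventually_ne
    (trivializationAt_ne_zero x (mem_baseSet_trivializationAt ℂ L x) hx),
    eventually_mem_baseSet (L := L) x] with y hy hyb h0
  apply hy
  have h0 : s y = 0 := h0
  have := trivializationAt_smul x hyb 0 (s y)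
  rwa [zero_smul, zero_mul, ← h0] at this

variable {Ω : SymplecticForm n M}

namespace Prequantization

variable (a : Prequantization L Ω)

lemma conn_congr {s t : Π x : M, L x} {x : M} (hs : SectionDiffAt n s x)
    (h : ∀ᶠ y in 𝓝 x, s y = t y) : a.conn s x = a.conn t x :=
  a.conn.isCovariantDerivativeOnUniv.congr_of_eventuallyEq hs (hs.congr h) Filter.univ_mem h

/-- The Leibniz rule for complex functions. -/
lemma conn_smul {s : Π x : M, L x} {h : M → ℂ} {x : M} (hs : SectionDiffAt n s x)
    (hh : MDifferentiableAt (𝓡 (2 * n)) 𝓘(ℝ, ℂ) h x) (v : TangentSpace (𝓡 (2 * n)) x) :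
    a.conn (fun y ↦ h y • s y) x v
      = mvfderiv (𝓡 (2 * n)) h x v • s x + h x • a.conn s x v := by
  have hI : SectionDiffAt n (fun y ↦ Complex.I • s y) x := hs.smul mdifferentiableAt_const
  have hre := mdifferentiableAt_clm_comp Complex.reCLM hh
  have him := mdifferentiableAt_clm_comp Complex.imCLM hh
  -- The connection has a Leibniz rule for real functions only, so `h` is split as `Re h + i Im h`
  -- and `conn_I` handles the second term.
  have e : (fun y ↦ h y • s y) = (fun y ↦ Complex.reCLM (h y)) • s
      + (fun y ↦ Complex.imCLM (h y)) • (fun y ↦ Complex.I • s y) := by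
    funext y
    change h y • s y = (h y).re • s y + (h y).im • Complex.I • s y
    rw [← Complex.coe_smul, ← Complex.coe_smul, smul_smul, ← add_smul, Complex.re_add_im]
  have hc := a.conn.isCovariantDerivativeOnUniv
  rw [e, hc.add (hre.smul_section hs) (him.smul_section hI), hc.leibniz hs hre,
    hc.leibniz hI him]
  simp only [add_apply, smul_apply,
    ContinuousLinearMap.smulRight_apply, mvfderiv_clm_comp _ hh, a.conn_I s x hs]
  simp only [Complex.reCLM_apply, Complex.imCLM_apply, ← Complex.coe_smul, smul_smul]
  conv_rhs => rw [← Complex.re_add_im (h x), ← Complex.re_add_im (mvfderiv (𝓡 (2 * n)) h x v)]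
  module

lemma smooth_conn_apply {s : Π x : M, L x} (hs : SmoothSectionOn n s univ)
    {X : Π x : M, TangentSpace (𝓡 (2 * n)) x} {U : Set M} (hX : SmoothFieldOn X U) :
    SmoothSectionOn n (fun y ↦ a.conn s y (X y)) U :=
  ContMDiffOn.clm_bundle_apply (a.smooth_conn.contMDiff.contMDiff (by exact hs)
    |>.mono (subset_univ U)) hX

end Prequantization

end Prequantum

/-! ### The form `ρ_s`, its curvature, and the unit section -/

section Special

variable {n : ℕ} {M : Type*} [TopologicalSpace M] [ChartedSpace (Vec (2 * n)) M]
  [IsManifold (𝓡 (2 * n)) ∞ M]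
  {L : M → Type*} [TopologicalSpace (TotalSpace ℂ L)]
  [∀ x, NormedAddCommGroup (L x)] [∀ x, InnerProductSpace ℂ (L x)] [FiberBundle ℂ L]
  [VectorBundle ℂ ℂ L] [VectorBundle ℝ ℂ L] [ContMDiffVectorBundle ∞ ℂ L (𝓡 (2 * n))]
  {Ω : SymplecticForm n M}

namespace Prequantization

lemma mdifferentiableAt_inner (a : Prequantization L Ω)
    {s t : Π x : M, L x} {U : Set M} (hU : IsOpen U)
    (hs : SmoothSectionOn n s U) (ht : SmoothSectionOn n t U) {x : M} (hx : x ∈ U) :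
    MDifferentiableAt (𝓡 (2 * n)) 𝓘(ℝ, ℂ) (fun y ↦ ⟪s y, t y⟫) x :=
  ((a.smooth_inner U hU s t hs ht).contMDiffAt (hU.mem_nhds hx)).mdifferentiableAt (by simp)

lemma mdifferentiableAt_inner_div (a : Prequantization L Ω)
    {s t : Π x : M, L x} {U : Set M} (hU : IsOpen U)
    (hs : SmoothSectionOn n s U) (ht : SmoothSectionOn n t U) {x : M} (hx : x ∈ U)
    (hsx : s x ≠ 0) :
    MDifferentiableAt (𝓡 (2 * n)) 𝓘(ℝ, ℂ) (fun y ↦ ⟪s y, t y⟫ / ⟪s y, s y⟫) x := by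
  have h0 : ⟪s x, s x⟫ ≠ 0 := inner_self_ne_zero.2 hsx
  have hinv : DifferentiableAt ℝ (fun z : ℂ ↦ z⁻¹) ⟪s x, s x⟫ :=
    (contDiffAt_inv ℝ h0 (n := 1)).differentiableAt (by simp)
  simp only [div_eq_mul_inv]
  exact (a.mdifferentiableAt_inner hU hs ht hx).mul
    (hinv.mdifferentiableAt.comp x (a.mdifferentiableAt_inner hU hs hs hx))

lemma rho_smul (a : Prequantization L Ω) {s : Π x : M, L x} {x : M} (hx : x ∈ (zeroSet s)ᶜ)
    (v : TangentSpace (𝓡 (2 * n)) x) : rho a s ⟨x, hx⟩ v • s x = a.conn s x v :=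
  line_smul_eq (finrank_fiber L x) hx _

/-- The function `ρ_s(X)`, extended by zero to the zeros of `s`. -/
def rhoField (a : Prequantization L Ω)
    (s : Π x : M, L x) (X : Π x : M, TangentSpace (𝓡 (2 * n)) x) (y : M) : ℂ :=
  ⟪s y, a.conn s y (X y)⟫ / ⟪s y, s y⟫

lemma rhoField_smul (a : Prequantization L Ω)
    {s : Π x : M, L x} (X : Π x : M, TangentSpace (𝓡 (2 * n)) x) {x : M}
    (hx : x ∈ (zeroSet s)ᶜ) : a.rhoField s X x • s x = a.conn s x (X x) :=
  line_smul_eq (finrank_fiber L x) hx _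

lemma mdifferentiableAt_rhoField (a : Prequantization L Ω)
    {s : Π x : M, L x} (hs : SmoothSectionOn n s univ)
    {X : Π x : M, TangentSpace (𝓡 (2 * n)) x} {U : Set M} (hU : IsOpen U)
    (hX : SmoothFieldOn X U) {x : M} (hxU : x ∈ U) (hx : x ∈ (zeroSet s)ᶜ) :
    MDifferentiableAt (𝓡 (2 * n)) 𝓘(ℝ, ℂ) (a.rhoField s X) x :=
  a.mdifferentiableAt_inner_div hU (hs.mono (subset_univ U)) (a.smooth_conn_apply hs hX) hxU hx

/-- The curvature identity `dρ_s = 2πi Ω` for commuting vector fields. -/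
lemma mvfderiv_rhoField_sub (a : Prequantization L Ω)
    {s : Π x : M, L x} (hs : SmoothSectionOn n s univ)
    {X Y : Π x : M, TangentSpace (𝓡 (2 * n)) x} {U : Set M} (hU : IsOpen U)
    (hX : SmoothFieldOn X U) (hY : SmoothFieldOn Y U) {x : M} (hxU : x ∈ U)
    (hx : x ∈ (zeroSet s)ᶜ) (hXY : mlieBracket (𝓡 (2 * n)) X Y x = 0) :
    mvfderiv (𝓡 (2 * n)) (a.rhoField s Y) x (X x) - mvfderiv (𝓡 (2 * n)) (a.rhoField s X) x (Y x)
      = 2 * (Real.pi : ℂ) * Complex.I * (Ω.form x (X x) (Y x) : ℂ) := by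
  -- Differentiate `∇_Z s = ρ(Z) s` once more by the complex Leibniz rule.
  have key : ∀ Z : Π x : M, TangentSpace (𝓡 (2 * n)) x, SmoothFieldOn Z U →
      ∀ w : TangentSpace (𝓡 (2 * n)) x, a.conn (fun y ↦ a.conn s y (Z y)) x w
        = mvfderiv (𝓡 (2 * n)) (a.rhoField s Z) x w • s x
          + a.rhoField s Z x • a.conn s x w := by
    intro Z hZ w
    rw [a.conn_congr ((a.smooth_conn_apply hs hZ).sectionDiffAt hU hxU)
      (t := fun y ↦ a.rhoField s Z y • s y),
      a.conn_smul (hs.sectionDiffAt isOpen_univ (mem_univ x))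
        (a.mdifferentiableAt_rhoField hs hU hZ hxU hx)]
    filter_upwards [(isOpen_compl_zeroSet hs).mem_nhds hx] with y hy
    exact (a.rhoField_smul Z hy).symm
  have hc := a.curvature U hU X Y s hX hY (hs.mono (subset_univ U)) x hxU
  rw [key Y hY, key X hX, hXY, map_zero, sub_zero, ← a.rhoField_smul X hx,
    ← a.rhoField_smul Y hx] at hc
  -- The products `ρ(X) ρ(Y)` cancel since scalars commute, leaving multiples of the nonzero vector
  -- `s x`.
  apply smul_left_injective ℂ (show s x ≠ 0 from hx)
  simp only
  rw [← hc]
  module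

/-- The unit section `s / |s|`. -/
def _root_.SBS.unitSection (s : Π x : M, L x) (y : M) : L y := ((‖s y‖⁻¹ : ℝ) : ℂ) • s y

/-- Smoothness of the metric is given through inner products, so `|s|⁻¹` is written as `(√(Re ⟨s,
s⟩))⁻¹`, which is smooth where `⟨s, s⟩` is nonzero. -/
lemma contMDiffOn_inv_norm (a : Prequantization L Ω)
    {s : Π x : M, L x} (hs : SmoothSectionOn n s univ) :
    ContMDiffOn (𝓡 (2 * n)) 𝓘(ℝ, ℝ) ∞ (fun y ↦ ‖s y‖⁻¹) (zeroSet s)ᶜ := by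
  intro x hx
  have h := (a.smooth_inner univ isOpen_univ s s hs hs).contMDiffAt (x := x) Filter.univ_mem
  have hpos : 0 < ‖s x‖ := norm_pos_iff.2 hx
  have hre : ∀ y, Complex.reCLM ⟪s y, s y⟫ = ‖s y‖ ^ 2 := fun y ↦ by
    rw [inner_self_eq_norm_sq_to_K, Complex.reCLM_apply]
    norm_cast
  have hF : ContDiffAt ℝ ∞ (fun z : ℂ ↦ (√(Complex.reCLM z))⁻¹) ⟪s x, s x⟫ := by
    have h0 : Complex.reCLM ⟪s x, s x⟫ ≠ 0 := by rw [hre]; positivity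
    refine (Complex.reCLM.contDiff.contDiffAt.sqrt h0).inv ?_
    rw [hre, Real.sqrt_sq hpos.le]
    exact hpos.ne'
  refine ((hF.contMDiffAt.comp x h).congr_of_eventuallyEq
    (Filter.Eventually.of_forall fun y ↦ ?_)).contMDiffWithinAt
  simp only [Function.comp_apply, hre, Real.sqrt_sq (norm_nonneg _)]

lemma smooth_unitSection (a : Prequantization L Ω)
    {s : Π x : M, L x} (hs : SmoothSectionOn n s univ) :
    SmoothSectionOn n (unitSection s) (zeroSet s)ᶜ :=
  (a.contMDiffOn_inv_norm hs).smul_section (hs.mono (subset_univ _))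

lemma _root_.SBS.inner_unitSection {s : Π x : M, L x} {x : M} (hx : x ∈ (zeroSet s)ᶜ) :
    ⟪unitSection s x, unitSection s x⟫ = 1 := by
  have h : (‖s x‖ : ℂ) ≠ 0 := by exact_mod_cast norm_ne_zero_iff.2 hx
  rw [unitSection, inner_smul_left, inner_smul_right, inner_self_eq_norm_sq_to_K,
    Complex.conj_ofReal]
  push_cast
  change (‖s x‖ : ℂ)⁻¹ * ((‖s x‖ : ℂ)⁻¹ * (‖s x‖ : ℂ) ^ 2) = 1
  field_simp

/-- The unit section is parallel in the directions annihilated by `Im ρ_s`. -/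
lemma conn_unitSection (a : Prequantization L Ω)
    {s : Π x : M, L x} (hs : SmoothSectionOn n s univ) {x : M}
    (hx : x ∈ (zeroSet s)ᶜ) {w : TangentSpace (𝓡 (2 * n)) x} (hw : (rho a s ⟨x, hx⟩ w).im = 0) :
    a.conn (unitSection s) x w = 0 := by
  have hU := isOpen_compl_zeroSet hs
  have hr : MDifferentiableAt (𝓡 (2 * n)) 𝓘(ℝ, ℝ) (fun y ↦ ‖s y‖⁻¹) x :=
    ((a.contMDiffOn_inv_norm hs).contMDiffAt (hU.mem_nhds hx)).mdifferentiableAt (by simp)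
  have hconn := a.conn_smul (hs.sectionDiffAt isOpen_univ (mem_univ x))
    (mdifferentiableAt_clm_comp Complex.ofRealCLM hr) w
  rw [mvfderiv_clm_comp _ hr, ← a.rho_smul hx, smul_smul, ← add_smul,
    ← Complex.re_add_im (rho a s ⟨x, hx⟩ w), hw] at hconn
  set r : ℝ := ‖s x‖⁻¹
  -- With `r = |s|⁻¹`, the derivative of `r s` is `(dr + r ρ) s`, and `ρ(w)` is real: a real
  -- multiple of `s`.
  obtain ⟨c, hc⟩ : ∃ c : ℝ, a.conn (unitSection s) x w = (c : ℂ) • s x := by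
    refine ⟨mvfderiv (𝓡 (2 * n)) (fun y ↦ ‖s y‖⁻¹) x w + r * (rho a s ⟨x, hx⟩ w).re, ?_⟩
    refine hconn.trans ?_
    simp [r]
  have hd := (a.smooth_unitSection hs).sectionDiffAt hU hx
  have hherm := a.hermitian _ _ x hd hd w
  -- Differentiating `⟨r s, r s⟩ = 1` gives `0 = 2 c |s|`, because `c` is real; so `c = 0`.
  rw [mvfderiv_congr (g' := fun _ ↦ (1 : ℂ)), mvfderiv_const, hc] at hherm
  · have hs0 : (‖s x‖ : ℂ) ≠ 0 := by exact_mod_cast norm_ne_zero_iff.2 hx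
    rw [unitSection, inner_smul_left, inner_smul_right, inner_smul_left, inner_smul_right,
      inner_self_eq_norm_sq_to_K, Complex.conj_ofReal, Complex.conj_ofReal] at hherm
    have h2 : (0 : ℂ) = 2 * (c * ‖s x‖) := by
      refine hherm.trans ?_
      push_cast
      change (c : ℂ) * ((‖s x‖ : ℂ)⁻¹ * (‖s x‖ : ℂ) ^ 2)
        + (‖s x‖ : ℂ)⁻¹ * (c * (‖s x‖ : ℂ) ^ 2) = _
      field_simp
      ring
    have h3 : (c : ℂ) = 0 := by simpa [hs0] using h2.symm
    rw [hc, h3, zero_smul]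
  · filter_upwards [hU.mem_nhds hx] with y hy using inner_unitSection hy

end Prequantization

/-! ### The two implications -/

variable {S : Type*} [TopologicalSpace S] [ChartedSpace (Vec n) S] [IsManifold (𝓡 n) ∞ S]
  {s : Π x : M, L x} {ι : S → M}

lemma ImRhoVanishesOn.isLagrangian (a : Prequantization L Ω) (hs : SmoothSectionOn n s univ)
    (hι : IsSmoothEmbedding (𝓡 n) (𝓡 (2 * n)) ∞ ι)
    (h : ImRhoVanishesOn a s ι) : IsLagrangian Ω ι := by
  intro x u v
  obtain ⟨φ, hφ, hxφ, hfields⟩ := exists_coordField_tangent (hι.isImmersion.isImmersionAt x)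
  obtain ⟨hx, -⟩ := h x
  have hιx : MDifferentiableAt (𝓡 n) (𝓡 (2 * n)) ι x := hι.contMDiff.mdifferentiable (by simp) x
  -- Along `S` the field stays tangent to `S`, so `Im ρ` of it vanishes near `x` on `S`, and so does
  -- its derivative in directions tangent to `S`.
  have hder : ∀ (u' : Vec (2 * n)), (∀ᶠ y in 𝓝 x, ∃ w : TangentSpace (𝓡 n) y,
      coordField φ u' (ι y) = mfderiv (𝓡 n) (𝓡 (2 * n)) ι y w) → ∀ w : TangentSpace (𝓡 n) x,
      (mvfderiv (𝓡 (2 * n)) (a.rhoField s (coordField φ u')) (ι x)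
        (mfderiv (𝓡 n) (𝓡 (2 * n)) ι x w)).im = 0 := by
    intro u' hu' w
    have hd := a.mdifferentiableAt_rhoField hs φ.open_source (contMDiffOn_coordField hφ u') hxφ hx
    rw [← Complex.imCLM_apply, ← mvfderiv_clm_comp _ hd,
      ← mvfderiv_comp_mfderiv (mdifferentiableAt_clm_comp _ hd) hιx,
      mvfderiv_congr (g' := fun _ ↦ (0 : ℝ)), mvfderiv_const]
    · rfl
    · filter_upwards [hu'] with y ⟨w', hw'⟩
      obtain ⟨hy, hρ⟩ := h y
      rw [Prequantization.rhoField, hw']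
      exact hρ w'
  obtain ⟨u', hu, hu'⟩ := hfields u
  obtain ⟨v', hv, hv'⟩ := hfields v
  have hc := a.mvfderiv_rhoField_sub hs φ.open_source (contMDiffOn_coordField hφ u')
    (contMDiffOn_coordField hφ v') hxφ hx (mlieBracket_coordField hφ u' v' hxφ)
  rw [hu, hv] at hc
  have him := congrArg Complex.im hc
  rw [Complex.sub_im, hder v' hv' u, hder u' hu' v] at him
  have h2 : (0 : ℝ) = 2 * Real.pi * Ω.form (ι x) (mfderiv (𝓡 n) (𝓡 (2 * n)) ι x u)
      (mfderiv (𝓡 n) (𝓡 (2 * n)) ι x v) := by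
    simpa using him
  simpa [Real.pi_ne_zero] using h2.symm

lemma ImRhoVanishesOn.isBSSection (a : Prequantization L Ω) (hs : SmoothSectionOn n s univ)
    (hι : IsSmoothEmbedding (𝓡 n) (𝓡 (2 * n)) ∞ ι)
    (h : ImRhoVanishesOn a s ι) : IsBSSection a ι (fun x ↦ unitSection s (ι x)) := by
  have hU := isOpen_compl_zeroSet hs
  have hsm := a.smooth_unitSection hs
  have hne : ∀ x : S, unitSection s (ι x) ≠ 0 := fun x h0 ↦ by
    simpa [h0] using inner_unitSection (h x).1
  refine ⟨⟨fun x ↦ ?_, ?_⟩, hne⟩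
  · exact ContMDiffAt.comp x (hsm.contMDiffAt (hU.mem_nhds (h x).1)) (hι.contMDiff x)
  · intro x V hV hxV t ht _ g hg hgt v
    have hιx : MDifferentiableAt (𝓡 n) (𝓡 (2 * n)) ι x := hι.contMDiff.mdifferentiable (by simp) x
    have hW : IsOpen (V ∩ (zeroSet s)ᶜ) := hV.inter hU
    have hxW : ι x ∈ V ∩ (zeroSet s)ᶜ := ⟨hxV, (h x).1⟩
    -- The test frame `t` is arbitrary; it is compared with the unit section `e = s/|s|` through `t
    -- = k e`.
    set k : M → ℂ := fun y ↦ ⟪unitSection s y, t y⟫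
    have hk : MDifferentiableAt (𝓡 (2 * n)) 𝓘(ℝ, ℂ) k (ι x) :=
      a.mdifferentiableAt_inner hW (hsm.mono inter_subset_right) (ht.mono inter_subset_left) hxW
    have htk : ∀ y ∈ (zeroSet s)ᶜ, t y = k y • unitSection s y := fun y hy ↦ by
      have h1 := inner_unitSection hy
      have h0 : unitSection s y ≠ 0 := fun h0 ↦ by simp [h0] at h1
      have := line_smul_eq (finrank_fiber L y) h0 (t y)
      rw [h1, div_one] at this
      exact this.symm
    have hconn : a.conn t (ι x) (mfderiv (𝓡 n) (𝓡 (2 * n)) ι x v)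
        = mvfderiv (𝓡 n) (fun y ↦ k (ι y)) x v • unitSection s (ι x) := by
      rw [a.conn_congr (ht.sectionDiffAt hV hxV) (t := fun y ↦ k y • unitSection s y),
        a.conn_smul (hsm.sectionDiffAt hU (h x).1) hk,
        a.conn_unitSection hs (h x).1 ((h x).2 v), smul_zero, add_zero,
        mvfderiv_comp_mfderiv hk hιx]
      filter_upwards [hU.mem_nhds (h x).1] with y hy using htk y hy
    -- Along `S` one has `e = g t = g k e`, so `g k = 1`. As `e` is parallel along `S`, the
    -- expression `dg t + g ∇t` equals `d(g k) e = 0`.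
    have hgk : (fun y ↦ g y * k (ι y)) =ᶠ[𝓝 x] fun _ ↦ (1 : ℂ) := by
      filter_upwards [hgt] with y hy
      rw [htk _ (h y).1, smul_smul] at hy
      apply smul_left_injective ℂ (hne y)
      simpa using hy.symm
    have hprod := mvfderiv_mul_complex (g := fun y ↦ k (ι y)) hg (hk.comp x hιx) v
    rw [mvfderiv_congr (g' := fun _ ↦ (1 : ℂ)) hgk, mvfderiv_const] at hprod
    rw [hconn, htk _ (h x).1, smul_smul, smul_smul, ← add_smul]
    convert! zero_smul ℂ (unitSection s (ι x)) using 2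
    rw [add_comm, mul_comm (mvfderiv (𝓡 n) g x v)]
    exact hprod.symm

lemma ImRhoVanishesOn.isSpecialBS (a : Prequantization L Ω) (hs : SmoothSectionOn n s univ)
    (hι : IsSmoothEmbedding (𝓡 n) (𝓡 (2 * n)) ∞ ι)
    (h : ImRhoVanishesOn a s ι) : IsSpecialBS a s ι := by
  have hσ := h.isBSSection a hs hι
  have hne : ∀ x : S, s (ι x) ≠ 0 := fun x ↦ (h x).1
  refine ⟨⟨h.isLagrangian a hs hι, _, hσ⟩, hne, _, hσ, 0, fun x ↦ ‖s (ι x)‖,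
    fun x ↦ norm_pos_iff.2 (hne x), fun x ↦ ?_⟩
  have h0 : (‖s (ι x)‖ : ℂ) ≠ 0 := by exact_mod_cast norm_ne_zero_iff.2 (hne x)
  simp [unitSection, smul_smul, h0]

/-- The ratio of a section along `ι` to the restriction of a nonvanishing section of `L` is
differentiable. -/
lemma mdifferentiableAt_ratio {σ : Π x : S, L (ι x)} {g : S → ℂ} {x : S}
    (hs : SectionDiffAt n s (ι x)) (hιx : MDifferentiableAt (𝓡 n) (𝓡 (2 * n)) ι x)
    (hσ : MDifferentiableAt (𝓡 n) ((𝓡 (2 * n)).prod 𝓘(ℝ, ℂ))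
      (fun y ↦ TotalSpace.mk' ℂ (ι y) (σ y)) x)
    (hne : ∀ y, s (ι y) ≠ 0) (hg : ∀ y, σ y = g y • s (ι y)) :
    MDifferentiableAt (𝓡 n) 𝓘(ℝ, ℂ) g x := by
  have h1 : MDifferentiableAt (𝓡 n) 𝓘(ℝ, ℂ)
      (fun y ↦ (trivializationAt ℂ L (ι x) ⟨ι y, s (ι y)⟩).2) x :=
    ((mdifferentiableAt_section (IB := 𝓡 (2 * n)) s).1 hs).comp x hιx
  have h2 := ((mdifferentiableAt_totalSpace _ _).1 hσ).2
  have h0 := trivializationAt_ne_zero (ι x) (mem_baseSet_trivializationAt ℂ L (ι x)) (hne x)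
  have hinv : DifferentiableAt ℝ (fun z : ℂ ↦ z⁻¹)
      (trivializationAt ℂ L (ι x) ⟨ι x, s (ι x)⟩).2 :=
    (contDiffAt_inv ℝ h0 (n := 1)).differentiableAt (by simp)
  -- In a local trivialization `g` is the coordinate of `σ` divided by that of `s`.
  refine (MDifferentiableAt.mul h2
    (MDifferentiableAt.comp x hinv.mdifferentiableAt h1)).congr_of_eventuallyEq ?_
  filter_upwards [hιx.continuousAt.eventually (eventually_mem_baseSet (L := L) (ι x))] with y hy
  have := trivializationAt_ne_zero (ι x) hy (hne y)
  change g y = (trivializationAt ℂ L (ι x) ⟨ι y, σ y⟩).2 * _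
  rw [hg y, trivializationAt_smul (ι x) hy]
  exact (mul_inv_cancel_right₀ this _).symm

lemma IsSpecialBS.imRhoVanishesOn (a : Prequantization L Ω) (hs : SmoothSectionOn n s univ)
    (hι : IsSmoothEmbedding (𝓡 n) (𝓡 (2 * n)) ∞ ι)
    (h : IsSpecialBS a s ι) : ImRhoVanishesOn a s ι := by
  obtain ⟨-, hne, σ, ⟨⟨hσ, hpar⟩, -⟩, c, f, hf, hsf⟩ := h
  intro x
  refine ⟨hne x, fun v ↦ ?_⟩
  have hU := isOpen_compl_zeroSet hs
  have hιx : MDifferentiableAt (𝓡 n) (𝓡 (2 * n)) ι x := hι.contMDiff.mdifferentiable (by simp) x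
  set E : ℂ := Complex.exp (Complex.I * c)
  have hE : E ≠ 0 := Complex.exp_ne_zero _
  set g : S → ℂ := fun y ↦ (f y * E)⁻¹
  have hf0 : ∀ y, (f y : ℂ) ≠ 0 := fun y ↦ by exact_mod_cast (hf y).ne'
  have hg : ∀ y, σ y = g y • s (ι y) := fun y ↦ by
    rw [hsf y, smul_smul, inv_mul_cancel₀ (mul_ne_zero (hf0 y) hE), one_smul]
  -- No regularity of `f` is assumed; differentiability of `g` comes from that of `σ` and `s`.
  have hgd : MDifferentiableAt (𝓡 n) 𝓘(ℝ, ℂ) g x :=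
    mdifferentiableAt_ratio (hs.sectionDiffAt isOpen_univ (mem_univ _)) hιx
      (hσ.mdifferentiable (by simp) x) hne hg
  -- The section `s` itself is the test frame, over the complement of its zeros.
  have hp := hpar x _ hU (hne x) s (hs.mono (subset_univ _)) (fun y hy ↦ hy) g hgd
    (Filter.Eventually.of_forall hg) v
  rw [← a.rho_smul (hne x), smul_smul, ← add_smul, smul_eq_zero_iff_left (hne x)] at hp
  -- `T z = Im (e^{ic} z)` is real-linear and kills `g`, since `e^{ic} g = 1/f`; hence it kills
  -- `dg`.
  let T : ℂ →L[ℝ] ℝ := Complex.imCLM ∘L ContinuousLinearMap.mul ℝ ℂ E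
  have hT : T (mvfderiv (𝓡 n) g x v) = 0 := by
    rw [← mvfderiv_clm_comp T hgd, mvfderiv_congr (g' := fun _ ↦ (0 : ℝ)), mvfderiv_const]
    · rfl
    · refine Filter.Eventually.of_forall fun y ↦ ?_
      have : E * g y = ((f y)⁻¹ : ℝ) := by
        have := hf0 y
        simp only [g]
        push_cast
        field_simp
      change (E * g y).im = 0
      rw [this, Complex.ofReal_im]
  set ρ := rho a s ⟨ι x, hne x⟩ (mfderiv (𝓡 n) (𝓡 (2 * n)) ι x v)
  have hρ : ρ = ((-f x : ℝ) : ℂ) * (E * mvfderiv (𝓡 n) g x v) := by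
    have h1 : mvfderiv (𝓡 n) g x v = -(g x * ρ) := eq_neg_of_add_eq_zero_left hp
    rw [h1]
    have := hf0 x
    simp only [g]
    push_cast
    field_simp
  rw [hρ, Complex.im_ofReal_mul]
  exact mul_eq_zero_of_right _ hT

end Special

end SBS

end

theorem theorem2 {n : ℕ} {M : Type*} [TopologicalSpace M] [T2Space M]
    [ChartedSpace (SBS.Vec (2 * n)) M] [IsManifold (𝓡 (2 * n)) ∞ M]
    (Ω : SBS.SymplecticForm n M)
    (L : M → Type*) [TopologicalSpace (TotalSpace ℂ L)]
    [∀ x, NormedAddCommGroup (L x)] [∀ x, InnerProductSpace ℂ (L x)] [FiberBundle ℂ L]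
    [VectorBundle ℂ ℂ L] [VectorBundle ℝ ℂ L] [ContMDiffVectorBundle ∞ ℂ L (𝓡 (2 * n))]
    (a : SBS.Prequantization L Ω)
    (s : Π x : M, L x) (hs : SBS.SmoothSectionOn n s univ)
    {S : Type*} [TopologicalSpace S] [ChartedSpace (SBS.Vec n) S] [IsManifold (𝓡 n) ∞ S]
    (ι : S → M) (hι : IsSmoothEmbedding (𝓡 n) (𝓡 (2 * n)) ∞ ι) :
    (SBS.IsSpecialBS a s ι ↔ SBS.ImRhoVanishesOn a s ι) ∧
      (SBS.ImRhoVanishesOn a s ι → Disjoint (range ι) (SBS.zeroSet s)) := by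
  refine ⟨⟨fun h ↦ h.imRhoVanishesOn a hs hι, fun h ↦ h.isSpecialBS a hs hι⟩, fun h ↦ ?_⟩
  rw [Set.disjoint_left]
  rintro _ ⟨x, rfl⟩
  exact (h x).1
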